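/- Let $S$ be a set with a countably generated $\sigma$-algebra $\mathcal F$ and a probability measure $\mathbb P$ on $\mathcal F$, let $b>0$, and let $s:S\times S\to[0,b]$ be symmetric and $\mathcal F\otimes\mathcal F$-measurable. Let $X,Y,Z$ be i.i.d. with law $\mathbb P$ and put $$\mathrm{Hyp}(S,\mathcal F,\mathbb P,s)=\mathbb E\big(\min\{s(X,Z),s(Y,Z)\}-s(X,Y)\big)_+ ,$$ where $x_+=\max\{x,0\}$. A leaf of a rooted (graph-theoretic) tree is a node of degree one other than the root. A tree $T$ with root $r$ is called compatible with $(S,\mathcal F)$ if $S$ is its set of leaves, $T\setminus S$ is finite, and for every node $v\in T\setminus S$ the set of leaves that are descendants of $v$ belongs to $\mathcal F$. Let $(x,y)_r=\frac12\big(d(x,r)+d(y,r)-d(x,y)\big)$, where $d$ is the graph distance on $T$, and put $$\mathrm{Tree}(S,\mathcal F,\mathbb P,s)=\inf_{T,\alpha}\mathbb E\big|s(X,Y)-\alpha\,(X,Y)_r\big| ,$$ the infimum being over all real $\alpha\ge 0$ and all rooted trees $T$ compatible with $(S,\mathcal F)$. (If $\mathcal F$ contains all singletons, then $(x,y)\mapsto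 (x,y)_r$ is measurable. Otherwise it need not be measurable on the diagonal, and $\mathbb E$ in the definition of $\mathrm{Tree}$ is read as the upper expectation, that is, the infimum of the expectations of the measurable majorants; it equals the expectation for measurable functions.) Then the following hold. 1. For all $\varepsilon>0$ and $b>0$ there is $\delta>0$, depending only on $\varepsilon$ and $b$, such that for all $(S,\mathcal F,\mathbb P,s)$ as above, $\mathrm{Hyp}(S,\mathcal F,\mathbb P,s)<\delta$ implies $\mathrm{Tree}(S,\mathcal F,\mathbb P,s)<\varepsilon$. 2. For all $\varepsilon>0$ and $b>0$ there is $\delta>0$, depending only on $\varepsilon$ and $b$, such that for all $(S,\mathcal F,\mathbb P,s)$ as above, $\mathrm{Tree}(S,\mathcal F,\mathbb P,s)<\delta$ implies $\mathrm{Hyp}(S,\mathcal F,\mathbb P,s)<\varepsilon$. 3. If $b=1$, then for all $(S,\mathcal F,\mathbb P,s)$ as above and every $\delta>0$, $\mathrm{Tree}(S,\mathcal F,\mathbb P,s)<\delta$ implies $\mathrm{Hyp}(S,\mathcal F,\mathbb P,s)\le 5\sqrt\delta$. -/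

import Mathlib

open MeasureTheory
open scoped ENNReal

universe u

namespace AvgHyp

/-- `s` is a similarity function on `S` with values in `[0, b]`: symmetric and measurable with
respect to the product σ-algebra on `S × S`. -/
structure IsSimilarity {S : Type u} [MeasurableSpace S] (b : ℝ) (s : S → S → ℝ) : Prop where
  measurable : Measurable (fun p : S × S => s p.1 p.2)
  symm : ∀ x y, s x y = s y x
  nonneg : ∀ x y, 0 ≤ s x y
  le_bound : ∀ x y, s x y ≤ b

/-- Average hyperbolicity `𝔼 (min {s(X,Z), s(Y,Z)} - s(X,Y))₊` for `X, Y, Z` i.i.d. with law `P`;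
the triple `(X, Y, Z)` is realised as the coordinates of `S × S × S` under the product law. -/
noncomputable def Hyp {S : Type u} [MeasurableSpace S] (P : Measure S) (s : S → S → ℝ) : ℝ :=
  ∫ p : S × S × S, max (min (s p.1 p.2.2) (s p.2.1 p.2.2) - s p.1 p.2.1) 0 ∂(P.prod (P.prod P))

/-- In the graph `G` with root `r`, the node `v` is a leaf: it is not the root and has degree one,
that is, exactly one neighbour. -/
def IsLeaf {V : Type u} (G : SimpleGraph V) (r v : V) : Prop :=
  v ≠ r ∧ ∃! w, G.Adj v w

/-- In the tree `G` with root `r`, the node `w` is a descendant of `v`: the path from the root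
to `w` passes through `v`. -/
def IsDescendant {V : Type u} (G : SimpleGraph V) (r v w : V) : Prop :=
  ∃ p : G.Walk r w, p.IsPath ∧ v ∈ p.support

/-- A rooted tree compatible with the measurable space `S`. The elements of `S` are the leaves
(the injection `leaf` identifies `S` with the set of all leaves), there are finitely many other
nodes, and for each of these the set of leaves descending from it is measurable. -/
structure CompatibleTree (S : Type u) [MeasurableSpace S] where
  /-- the nodes -/
  V : Type u
  /-- the edges -/
  G : SimpleGraph V
  isTree : G.IsTree
  /-- the root -/
  root : V
  /-- the identification of `S` with the set of leaves -/
  leaf : S → V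
  leaf_injective : Function.Injective leaf
  range_leaf : Set.range leaf = {v | IsLeaf G root v}
  finite_nonleaf : {v | ¬ IsLeaf G root v}.Finite
  measurableSet_leaves :
    ∀ v, ¬ IsLeaf G root v → MeasurableSet {x : S | IsDescendant G root v (leaf x)}

/-- The Gromov product `(x, y)_r` of two leaves under the graph distance, based at the root. -/
noncomputable def CompatibleTree.gromovProduct {S : Type u} [MeasurableSpace S]
    (T : CompatibleTree S) (x y : S) : ℝ :=
  ((T.G.dist (T.leaf x) T.root : ℝ) + (T.G.dist (T.leaf y) T.root : ℝ)
    - (T.G.dist (T.leaf x) (T.leaf y) : ℝ)) / 2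

/-- Expectation of a `[0, ∞]`-valued function, as an upper integral: the infimum of the
expectations of all measurable majorants. For a measurable function it is the usual expectation
(`upperExpectation_eq_lintegral`). -/
noncomputable def upperExpectation {Ω : Type u} [MeasurableSpace Ω] (μ : Measure Ω)
    (f : Ω → ℝ≥0∞) : ℝ≥0∞ :=
  ⨅ (g : Ω → ℝ≥0∞) (_ : Measurable g) (_ : f ≤ g), ∫⁻ ω, g ω ∂μ

theorem upperExpectation_eq_lintegral {Ω : Type u} [MeasurableSpace Ω] (μ : Measure Ω)
    {f : Ω → ℝ≥0∞} (hf : Measurable f) : upperExpectation μ f = ∫⁻ ω, f ω ∂μ :=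
  le_antisymm (iInf_le_of_le f (iInf_le_of_le hf (iInf_le _ le_rfl)))
    (le_iInf fun _ => le_iInf fun _ => le_iInf fun h => lintegral_mono h)

/-- The tree-likeness `inf 𝔼 |s(X,Y) - α (X,Y)_r|`, over all real `α ≥ 0` and all rooted trees
compatible with `S`, for `X, Y` independent with law `P`.

The function `(x, y) ↦ (x, y)_r` differs from a measurable function only by the indicator of the
diagonal, since a leaf is its own ancestor. If the singletons of the countably generated `S` are
measurable, then so is the diagonal, and the upper expectation is the expectation. Otherwise
the expectation need not exist, and the upper one replaces it. -/
noncomputable def Tree {S : Type u} [MeasurableSpace S] (P : Measure S) (s : S → S → ℝ) : ℝ≥0∞ :=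
  ⨅ (T : CompatibleTree S) (α : ℝ) (_ : 0 ≤ α),
    upperExpectation (P.prod P)
      (fun p => ENNReal.ofReal |s p.1 p.2 - α * T.gromovProduct p.1 p.2|)

end AvgHyp

namespace AvgHyp

/-! ### Trees are `0`-hyperbolic -/

section Graph

variable {V : Type*} {G : SimpleGraph V}

/-! From trees to small average hyperbolicity: trees are `0`-hyperbolic (`four_point`), so the
excess of `s` at a triple is at most the sum of the deviations of `s` from `α (·,·)_r` on its three
pairs. Integrating gives `Hyp ≤ 3 * Tree`, which yields the second and third claims.

From small average hyperbolicity to trees: cut `s` at a threshold `t` and consider the relation `t <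
s x y`. For an exact ultrametric this is transitive; in general its failures are the cherries,
triples with exactly two related pairs. A triple is a cherry only for `t` in a set whose length is
at most the sum of three excesses, so the cherry measure integrates over `t` to at most `3 * Hyp`,
and every interval `(i η, (i+1) η)` contains a threshold with few cherries (`exists_threshold`). A
relation with few cherries is close to a partition of part of the space into finitely many clusters,
found greedily (`exists_clustering`).

The clusters of `x` at the levels `0, …, k-1`, read until the first level at which `x` has none,
form a word, and the prefixes of these words form a tree. Clusters of different levels need not be
nested; the common prefix of two words still gives `s` up to `η` at every pair that is a misfit at
no level (`abs_sub_lcpLength_label_le`). The remaining pairs have small measure and bounded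
deviation. -/

theorem length_eq_dist_of_isPath (hG : G.IsTree) {u v : V} {p : G.Walk u v} (hp : p.IsPath) :
    p.length = G.dist u v := by
  obtain ⟨q, hq, hql⟩ := hG.connected.exists_path_of_dist u v
  rw [← hql, (hG.existsUnique_path u v).unique hp hq]

theorem dist_add_dist_of_mem_support (hG : G.IsTree) {u v w : V} {p : G.Walk u v} (hp : p.IsPath)
    (hw : w ∈ p.support) : G.dist u w + G.dist w v = G.dist u v := by
  classical
  rw [← length_eq_dist_of_isPath hG (hp.takeUntil hw),
    ← length_eq_dist_of_isPath hG (hp.dropUntil hw), ← length_eq_dist_of_isPath hG hp,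
    ← SimpleGraph.Walk.length_append, SimpleGraph.Walk.take_spec]

theorem isPath_append {u v w : V} {p : G.Walk u v} {q : G.Walk v w} (hp : p.IsPath) (hq : q.IsPath)
    (h : ∀ x ∈ p.support, x ∈ q.support → x = v) : (p.append q).IsPath := by
  rw [SimpleGraph.Walk.isPath_def, SimpleGraph.Walk.support_append, List.nodup_append']
  refine ⟨hp.support_nodup, hq.support_nodup.tail, fun x hx hx' => ?_⟩
  obtain rfl := h x hx (List.mem_of_mem_tail hx')
  have := hq.support_nodup
  rw [← SimpleGraph.Walk.cons_tail_support] at this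
  exact (List.nodup_cons.1 this).1 hx'

/-- The projection of a vertex `x` of a tree to the path from `u` to `v`. -/
theorem exists_projection (hG : G.IsTree) {u v : V} {p : G.Walk u v} (hp : p.IsPath) (x : V) :
    ∃ a ∈ p.support, G.dist x u = G.dist x a + G.dist a u ∧
      G.dist x v = G.dist x a + G.dist a v := by
  classical
  obtain ⟨a, ha, hmin⟩ := p.support.toFinset.exists_min_image (fun a => G.dist x a)
    ⟨u, by simp⟩
  simp only [List.mem_toFinset] at ha hmin
  obtain ⟨g, hg, hgl⟩ := hG.connected.exists_path_of_dist x a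
  -- `a` is a point of `p` nearest to `x`, so the geodesic from `x` to `a` meets `p` only in `a`.
  -- Followed by either half of `p` it remains a path, and paths in a tree realise distances.
  have key : ∀ y ∈ g.support, y ∈ p.support → y = a := by
    intro y hy hyp
    have h1 := dist_add_dist_of_mem_support hG hg hy
    have h2 := hmin y hyp
    exact (hG.connected.dist_eq_zero_iff).1 (by omega)
  refine ⟨a, ha, ?_, ?_⟩
  · have := isPath_append hg (hp.takeUntil ha).reverse fun y hy hy' =>
      key y hy (p.support_takeUntil_subset_support ha (by simpa using hy'))
    rw [← length_eq_dist_of_isPath hG this, SimpleGraph.Walk.length_append, hgl,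
      length_eq_dist_of_isPath hG (hp.takeUntil ha).reverse]
  · have := isPath_append hg (hp.dropUntil ha) fun y hy hy' =>
      key y hy (p.support_dropUntil_subset_support ha hy')
    rw [← length_eq_dist_of_isPath hG this, SimpleGraph.Walk.length_append, hgl,
      length_eq_dist_of_isPath hG (hp.dropUntil ha)]

/-- Project `x` and `y` to the path from `r` to `z`. The order of the projections along this path
decides which term of the maximum gives the bound. -/
theorem four_point (hG : G.IsTree) (r x y z : V) :
    G.dist x y + G.dist r z ≤ max (G.dist x z + G.dist y r) (G.dist y z + G.dist x r) := by
  classical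
  obtain ⟨p, hp, -⟩ := hG.connected.exists_path_of_dist r z
  obtain ⟨a, ha, ha1, ha2⟩ := exists_projection hG hp x
  obtain ⟨b, hb, hb1, hb2⟩ := exists_projection hG hp y
  have h1 := dist_add_dist_of_mem_support hG hp ha
  have h2 := dist_add_dist_of_mem_support hG hp hb
  have t1 := hG.connected.dist_triangle (u := x) (v := a) (w := y)
  have t2 := hG.connected.dist_triangle (u := a) (v := b) (w := y)
  have c1 := G.dist_comm (u := b) (v := y)
  have c2 := G.dist_comm (u := r) (v := a)
  have c3 := G.dist_comm (u := r) (v := b)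
  have c4 := G.dist_comm (u := a) (v := b)
  have hsplit : b ∈ (p.takeUntil a ha).support ∨ b ∈ (p.dropUntil a ha).support := by
    rw [← SimpleGraph.Walk.mem_support_append_iff, SimpleGraph.Walk.take_spec]
    exact hb
  rcases hsplit with h | h
  · have h3 := dist_add_dist_of_mem_support hG (hp.takeUntil ha) h
    omega
  · have h3 := dist_add_dist_of_mem_support hG (hp.dropUntil ha) h
    omega

end Graph

theorem CompatibleTree.min_gromovProduct_le {S : Type u} [MeasurableSpace S]
    (T : CompatibleTree S) (x y z : S) :
    min (T.gromovProduct x z) (T.gromovProduct y z) ≤ T.gromovProduct x y := by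
  have h := four_point T.isTree T.root (T.leaf x) (T.leaf y) (T.leaf z)
  rw [T.G.dist_comm (u := T.root)] at h
  unfold CompatibleTree.gromovProduct
  rcases le_max_iff.1 h with h | h
  · refine min_le_of_left_le ?_
    have : ((T.G.dist (T.leaf x) (T.leaf y) + T.G.dist (T.leaf z) T.root : ℕ) : ℝ) ≤
      (T.G.dist (T.leaf x) (T.leaf z) + T.G.dist (T.leaf y) T.root : ℕ) := by exact_mod_cast h
    push_cast at this
    linarith
  · refine min_le_of_right_le ?_
    have : ((T.G.dist (T.leaf x) (T.leaf y) + T.G.dist (T.leaf z) T.root : ℕ) : ℝ) ≤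
      (T.G.dist (T.leaf y) (T.leaf z) + T.G.dist (T.leaf x) T.root : ℕ) := by exact_mod_cast h
    push_cast at this
    linarith

/-! ### Average hyperbolicity is at most three times the tree-likeness -/

/-- The deviation of `s` from the ultrametric inequality at a triple of points. -/
noncomputable def excess {S : Type u} (s : S → S → ℝ) (x y z : S) : ℝ :=
  max (min (s x z) (s y z) - s x y) 0

theorem excess_nonneg {S : Type u} (s : S → S → ℝ) (x y z : S) : 0 ≤ excess s x y z :=
  le_max_right _ _

section Excess

variable {S : Type u} [MeasurableSpace S] {b : ℝ} {s : S → S → ℝ}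

theorem IsSimilarity.measurable_comp (hs : IsSimilarity b s) {α : Type*} [MeasurableSpace α]
    {f g : α → S} (hf : Measurable f) (hg : Measurable g) : Measurable fun a => s (f a) (g a) :=
  hs.measurable.comp (hf.prodMk hg)

theorem IsSimilarity.measurable_excess (hs : IsSimilarity b s) {α : Type*} [MeasurableSpace α]
    {f g h : α → S} (hf : Measurable f) (hg : Measurable g) (hh : Measurable h) :
    Measurable fun a => excess s (f a) (g a) (h a) :=
  (((hs.measurable_comp hf hh).min (hs.measurable_comp hg hh)).sub
    (hs.measurable_comp hf hg)).max measurable_const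

theorem IsSimilarity.excess_le (hs : IsSimilarity b s) (x y z : S) : excess s x y z ≤ b := by
  have := hs.nonneg x y
  have h1 := hs.le_bound x z
  have h2 := hs.nonneg x z
  exact max_le (by linarith [min_le_left (s x z) (s y z)]) (by linarith)

variable (P : Measure S) [IsProbabilityMeasure P]

theorem ofReal_hyp (hs : IsSimilarity b s) :
    ENNReal.ofReal (Hyp P s) = ∫⁻ x, ∫⁻ y, ∫⁻ z, ENNReal.ofReal (excess s x y z) ∂P ∂P ∂P := by
  have hm : Measurable fun p : S × S × S => excess s p.1 p.2.1 p.2.2 :=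
    hs.measurable_excess (by fun_prop) (by fun_prop) (by fun_prop)
  have hint : Integrable (fun p : S × S × S => excess s p.1 p.2.1 p.2.2) (P.prod (P.prod P)) :=
    Integrable.of_bound hm.aestronglyMeasurable b (Filter.Eventually.of_forall fun p => by
      rw [Real.norm_of_nonneg (excess_nonneg s _ _ _)]
      exact hs.excess_le _ _ _)
  have h := ofReal_integral_eq_lintegral_ofReal hint
    (Filter.Eventually.of_forall fun p => excess_nonneg s _ _ _)
  rw [lintegral_prod _ (by fun_prop)] at h
  refine h.trans (lintegral_congr fun x => ?_)
  exact lintegral_prod _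
    (hm.comp (by fun_prop : Measurable fun q : S × S => (x, q))).ennreal_ofReal.aemeasurable

theorem hyp_le_bound (hs : IsSimilarity b s) : Hyp P s ≤ b := by
  have h := norm_integral_le_of_norm_le_const (μ := P.prod (P.prod P)) (C := b)
    (f := fun p : S × S × S => excess s p.1 p.2.1 p.2.2) (Filter.Eventually.of_forall fun p => by
      rw [Real.norm_of_nonneg (excess_nonneg s _ _ _)]
      exact hs.excess_le _ _ _)
  refine (le_abs_self _).trans (h.trans ?_)
  simp

theorem excess_le_of_gromovProduct (T : CompatibleTree S) {α : ℝ} (hα : 0 ≤ α) (x y z : S) :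
    excess s x y z ≤ |s x y - α * T.gromovProduct x y| + (|s x z - α * T.gromovProduct x z| +
      |s y z - α * T.gromovProduct y z|) := by
  refine max_le ?_ (by positivity)
  have h := mul_le_mul_of_nonneg_left (T.min_gromovProduct_le x y z) hα
  rw [mul_min_of_nonneg _ _ hα] at h
  have h1 := neg_abs_le (s x y - α * T.gromovProduct x y)
  have h2 := le_abs_self (s x z - α * T.gromovProduct x z)
  have h3 := le_abs_self (s y z - α * T.gromovProduct y z)
  have h4 := abs_nonneg (s x z - α * T.gromovProduct x z)
  have h5 := abs_nonneg (s y z - α * T.gromovProduct y z)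
  rcases min_le_iff.1 h with h | h
  · linarith [min_le_left (s x z) (s y z)]
  · linarith [min_le_right (s x z) (s y z)]

/-- The Gromov product may fail to be measurable, so a measurable majorant `g` of the deviation is
integrated in its place; each of the three pairs contributes `∫⁻ g`. -/
theorem ofReal_hyp_le_lintegral (hs : IsSimilarity b s) (T : CompatibleTree S) {α : ℝ}
    (hα : 0 ≤ α) {g : S × S → ℝ≥0∞} (hg : Measurable g)
    (hle : (fun p : S × S => ENNReal.ofReal |s p.1 p.2 - α * T.gromovProduct p.1 p.2|) ≤ g) :
    ENNReal.ofReal (Hyp P s) ≤ 3 * ∫⁻ p, g p ∂(P.prod P) := by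
  have hpair : Measurable fun q : S × S => ∫⁻ z, g (q.1, z) ∂P :=
    (hg.lintegral_prod_right').comp measurable_fst
  have hpair' : Measurable fun x : S => ∫⁻ z, g (x, z) ∂P := hg.lintegral_prod_right'
  have hI : ∫⁻ p, g p ∂(P.prod P) = ∫⁻ x, ∫⁻ y, g (x, y) ∂P ∂P :=
    lintegral_prod _ hg.aemeasurable
  calc ENNReal.ofReal (Hyp P s)
      = ∫⁻ x, ∫⁻ y, ∫⁻ z, ENNReal.ofReal (excess s x y z) ∂P ∂P ∂P := ofReal_hyp P hs
    _ ≤ ∫⁻ x, ∫⁻ y, ∫⁻ z, (g (x, y) + (g (x, z) + g (y, z))) ∂P ∂P ∂P := by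
        refine lintegral_mono fun x => lintegral_mono fun y => lintegral_mono fun z => ?_
        refine (ENNReal.ofReal_le_ofReal (excess_le_of_gromovProduct T hα x y z)).trans ?_
        rw [ENNReal.ofReal_add (by positivity) (by positivity),
          ENNReal.ofReal_add (by positivity) (by positivity)]
        exact add_le_add (hle (x, y)) (add_le_add (hle (x, z)) (hle (y, z)))
    _ = ∫⁻ x, ∫⁻ y, (g (x, y) + (∫⁻ z, g (x, z) ∂P + ∫⁻ z, g (y, z) ∂P)) ∂P ∂P := by
        refine lintegral_congr fun x => lintegral_congr fun y => ?_
        rw [lintegral_add_left measurable_const, lintegral_add_left (by fun_prop)]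
        simp
    _ = ∫⁻ x, (∫⁻ y, g (x, y) ∂P + (∫⁻ z, g (x, z) ∂P + ∫⁻ p, g p ∂(P.prod P))) ∂P := by
        refine lintegral_congr fun x => ?_
        rw [lintegral_add_left (by fun_prop), lintegral_add_left measurable_const, hI]
        simp
    _ = 3 * ∫⁻ p, g p ∂(P.prod P) := by
        rw [lintegral_add_left hpair', lintegral_add_left hpair', ← hI]
        simp only [lintegral_const, measure_univ, mul_one]
        ring

theorem ofReal_hyp_le_three_mul_tree (hs : IsSimilarity b s) :
    ENNReal.ofReal (Hyp P s) ≤ 3 * Tree P s := by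
  rw [mul_comm, ← ENNReal.div_le_iff (by norm_num) (by norm_num)]
  refine le_iInf fun T => le_iInf fun α => le_iInf fun hα => le_iInf fun g => le_iInf fun hg =>
    le_iInf fun hle => ?_
  rw [ENNReal.div_le_iff (by norm_num) (by norm_num), mul_comm]
  exact ofReal_hyp_le_lintegral P hs T hα hg hle

theorem hyp_le_of_tree_lt (hs : IsSimilarity b s) {δ : ℝ} (hδ : 0 < δ)
    (h : Tree P s < ENNReal.ofReal δ) : Hyp P s ≤ 3 * δ := by
  have h1 : ENNReal.ofReal (Hyp P s) ≤ ENNReal.ofReal (3 * δ) := by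
    rw [ENNReal.ofReal_mul (by norm_num)]
    refine (ofReal_hyp_le_three_mul_tree P hs).trans ?_
    have : ENNReal.ofReal 3 = 3 := by norm_num
    rw [this]
    gcongr
  exact (ENNReal.ofReal_le_ofReal_iff (by positivity)).1 h1

/-- For `δ ≤ 1` the bound `3 * δ` suffices, since then `δ ≤ √δ`; for larger `δ` the trivial bound
`Hyp ≤ 1` does. -/
theorem hyp_le_five_sqrt (hs : IsSimilarity 1 s) {δ : ℝ} (hδ : 0 < δ)
    (h : Tree P s < ENNReal.ofReal δ) : Hyp P s ≤ 5 * Real.sqrt δ := by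
  have h1 := hyp_le_of_tree_lt P hs hδ h
  have h2 := hyp_le_bound P hs
  have h3 := Real.sq_sqrt hδ.le
  have h4 := Real.sqrt_nonneg δ
  rcases le_total (Real.sqrt δ) 1 with h5 | h5 <;> nlinarith

end Excess

/-! ### Trees of prefix-closed sets of lists -/

/-- The length of the longest common prefix of two lists. -/
noncomputable def lcpLength {A : Type*} : List A → List A → ℕ
  | a :: l, b :: m => open Classical in if a = b then lcpLength l m + 1 else 0
  | _, _ => 0

section Prefix

variable {A : Type*}

@[simp] theorem lcpLength_nil_left (m : List A) : lcpLength [] m = 0 := by simp [lcpLength]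

@[simp] theorem lcpLength_nil_right (l : List A) : lcpLength l [] = 0 := by
  cases l <;> simp [lcpLength]

theorem lcpLength_cons (a b : A) (l m : List A) [Decidable (a = b)] :
    lcpLength (a :: l) (b :: m) = if a = b then lcpLength l m + 1 else 0 := by
  simp only [lcpLength]; congr

theorem lcpLength_self (l : List A) : lcpLength l l = l.length := by
  induction l with
  | nil => simp
  | cons a l ih => classical simp [lcpLength_cons, ih]

theorem lcpLength_le_left (l m : List A) : lcpLength l m ≤ l.length := by
  classical
  induction l generalizing m with
  | nil => simp
  | cons a l ih =>
    cases m with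
    | nil => simp
    | cons b m =>
      rw [lcpLength_cons]
      split_ifs
      · simpa using ih m
      · simp

theorem lcpLength_le_append (l m m' : List A) : lcpLength l m ≤ lcpLength l (m ++ m') := by
  classical
  induction l generalizing m with
  | nil => simp
  | cons a l ih =>
    cases m with
    | nil => simp
    | cons b m =>
      rw [List.cons_append, lcpLength_cons, lcpLength_cons]
      split_ifs
      · simpa using ih m
      · simp

theorem lcpLength_concat_le (l m : List A) (a : A) :
    lcpLength l (m ++ [a]) ≤ lcpLength l m + 1 := by
  classical
  induction l generalizing m with
  | nil => simp
  | cons c l ih =>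
    cases m with
    | nil =>
      rw [List.nil_append, lcpLength_cons]
      split_ifs <;> simp
    | cons b m =>
      rw [List.cons_append, lcpLength_cons, lcpLength_cons]
      split_ifs
      · simpa using ih m
      · simp

theorem take_lcpLength (l m : List A) : l.take (lcpLength l m) = m.take (lcpLength l m) := by
  classical
  induction l generalizing m with
  | nil => simp
  | cons a l ih =>
    cases m with
    | nil => simp
    | cons b m =>
      rw [lcpLength_cons]
      split_ifs with h
      · simp [h, ih m]
      · simp

/-- The graph on a set of lists in which a list is joined to its one-letter extensions. -/
def prefixGraph (K : Set (List A)) : SimpleGraph K where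
  Adj l m := ∃ a, (m : List A) = (l : List A) ++ [a] ∨ (l : List A) = (m : List A) ++ [a]
  symm := ⟨fun _ _ ⟨a, h⟩ => ⟨a, h.symm⟩⟩
  loopless := ⟨fun l ⟨a, h⟩ => by
    rcases h with h | h <;> simpa using congrArg List.length h⟩

variable {K : Set (List A)}

theorem prefixGraph_adj {l m : K} :
    (prefixGraph K).Adj l m ↔
      ∃ a, (m : List A) = (l : List A) ++ [a] ∨ (l : List A) = (m : List A) ++ [a] := Iff.rfl

theorem exists_isPath_of_prefix (hK : ∀ l m : List A, l <+: m → m ∈ K → l ∈ K) (l : K)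
    (t : List A) (ht : (l : List A) ++ t ∈ K) :
    ∃ p : (prefixGraph K).Walk l ⟨l ++ t, ht⟩, p.IsPath ∧ p.length = t.length ∧
      ∀ v : K, v ∈ p.support ↔ (l : List A) <+: v ∧ (v : List A) <+: l ++ t := by
  induction t using List.reverseRecOn with
  | nil =>
    have e : (⟨(l : List A) ++ [], ht⟩ : K) = l := Subtype.ext (List.append_nil _)
    rw [e]
    refine ⟨.nil, .nil, rfl, fun v => ?_⟩
    simp only [SimpleGraph.Walk.support_nil, List.mem_singleton, List.append_nil]
    exact ⟨fun h => h ▸ ⟨List.prefix_rfl, List.prefix_rfl⟩, fun h => Subtype.ext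
      (h.2.eq_of_length_le h.1.length_le)⟩
  | append_singleton t a ih =>
    have ht' : (l : List A) ++ t ∈ K := hK _ _ ⟨[a], by simp⟩ ht
    obtain ⟨p, hp, hpl, hps⟩ := ih ht'
    have hadj : (prefixGraph K).Adj ⟨l ++ t, ht'⟩ ⟨l ++ (t ++ [a]), ht⟩ :=
      prefixGraph_adj.2 ⟨a, Or.inl (by simp)⟩
    refine ⟨p.concat hadj, hp.concat ?_ hadj, by simp [hpl], fun v => ?_⟩
    · rw [hps]
      rintro ⟨-, h⟩
      simpa using h.length_le
    · rw [SimpleGraph.Walk.support_concat, List.mem_append, List.mem_singleton, hps]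
      have hiff : (v : List A) <+: l ++ (t ++ [a]) ↔
          (v : List A) = l ++ t ++ [a] ∨ (v : List A) <+: l ++ t := by
        rw [← List.append_assoc, List.prefix_concat_iff]
      rw [hiff]
      constructor
      · rintro (h | rfl)
        · exact ⟨h.1, Or.inr h.2⟩
        · exact ⟨⟨t ++ [a], by simp⟩, Or.inl (by simp)⟩
      · rintro ⟨h1, h | h⟩
        · exact Or.inr (Subtype.ext (by simpa using h))
        · exact Or.inl ⟨h1, h⟩

/-- Every edge is a bridge: the edge from `l` to its extension `m` is the only one that leaves the
set of lists with prefix `m`. -/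
theorem prefixGraph_isAcyclic (K : Set (List A)) : (prefixGraph K).IsAcyclic := by
  rw [SimpleGraph.isAcyclic_iff_forall_adj_isBridge]
  have key : ∀ (l m : K) (a : A), (m : List A) = l ++ [a] →
      (prefixGraph K).IsBridge s(l, m) := by
    intro l m a h
    rw [SimpleGraph.isBridge_iff]
    rintro ⟨p⟩
    have inv : ∀ (u v : K) (_ : ((prefixGraph K).deleteEdges {s(l, m)}).Walk u v),
        (m : List A) <+: v → (m : List A) <+: u := by
      intro u v q
      induction q with
      | nil => exact id
      | @cons u w v huw _ ih =>
        intro hv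
        have hw := ih hv
        rw [SimpleGraph.deleteEdges_adj] at huw
        obtain ⟨huw, hne⟩ := huw
        obtain ⟨c, hc | hc⟩ := prefixGraph_adj.1 huw
        · rw [hc, List.prefix_concat_iff] at hw
          rcases hw with hw | hw
          · refine absurd ?_ hne
            have e1 : w = m := Subtype.ext (hc.trans hw.symm)
            have e2 : u = l := Subtype.ext (List.append_inj_left' (hw.symm.trans h) rfl)
            simp [e1, e2]
          · exact hw
        · exact hw.trans ⟨[c], hc.symm⟩
    have := (inv l m p List.prefix_rfl).length_le
    simp [h] at this
  intro l m hadj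
  obtain ⟨a, h | h⟩ := prefixGraph_adj.1 hadj
  · exact key l m a h
  · rw [Sym2.eq_swap]
    exact key m l a h

theorem prefixGraph_isTree (hK : ∀ l m : List A, l <+: m → m ∈ K → l ∈ K) (h0 : [] ∈ K) :
    (prefixGraph K).IsTree := by
  have h : ∀ v : K, (prefixGraph K).Reachable ⟨[], h0⟩ v := fun v => by
    obtain ⟨p, -⟩ := exists_isPath_of_prefix hK ⟨[], h0⟩ v (by simp)
    exact ⟨p.copy rfl (by simp)⟩
  have : Nonempty K := ⟨⟨[], h0⟩⟩
  exact ⟨⟨fun u v => (h u).symm.trans (h v)⟩, prefixGraph_isAcyclic K⟩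

theorem isDescendant_prefixGraph_iff {A : Type u} {K : Set (List A)}
    (hK : ∀ l m : List A, l <+: m → m ∈ K → l ∈ K) (h0 : [] ∈ K)
    (v w : K) : IsDescendant (prefixGraph K) ⟨[], h0⟩ v w ↔ (v : List A) <+: w := by
  obtain ⟨p, hp, -, hps⟩ := exists_isPath_of_prefix hK ⟨[], h0⟩ w (by simp)
  have hw : (⟨[] ++ (w : List A), by simp⟩ : K) = w := by simp
  have hp' : ∃ p : (prefixGraph K).Walk ⟨[], h0⟩ w, p.IsPath ∧
      ∀ v : K, v ∈ p.support ↔ (v : List A) <+: w :=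
    ⟨p.copy rfl hw, by simpa using hp, fun v => by simp [hps]⟩
  obtain ⟨p, hp, hps⟩ := hp'
  constructor
  · rintro ⟨q, hq, hv⟩
    rw [((prefixGraph_isTree hK h0).existsUnique_path _ _).unique hq hp, hps] at hv
    exact hv
  · exact fun h => ⟨p, hp, (hps v).2 h⟩

theorem dist_prefixGraph (hK : ∀ l m : List A, l <+: m → m ∈ K → l ∈ K) (h0 : [] ∈ K) (l m : K) :
    (prefixGraph K).dist l m + 2 * lcpLength (l : List A) m =
      (l : List A).length + (m : List A).length := by
  have hT := prefixGraph_isTree hK h0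
  apply le_antisymm
  -- Upper bound: go from `l` to `m` through their longest common prefix.
  · set n := lcpLength (l : List A) m with hn
    have hpre : (l : List A).take n ∈ K := hK _ _ (List.take_prefix _ _) l.2
    have aux : ∀ w : K, (l : List A).take n <+: w →
        (prefixGraph K).dist ⟨_, hpre⟩ w + ((l : List A).take n).length ≤ (w : List A).length := by
      rintro ⟨w, hw⟩ ⟨t, rfl⟩
      obtain ⟨p, -, hpl, -⟩ := exists_isPath_of_prefix hK ⟨_, hpre⟩ t hw
      have := SimpleGraph.dist_le p
      simp only [List.length_append] at this ⊢
      exact (Nat.add_le_add_right this _).trans (by omega)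
    have h1 := aux l (List.take_prefix _ _)
    have h2 := aux m (by rw [hn, take_lcpLength]; exact List.take_prefix _ _)
    have h3 : ((l : List A).take n).length = n := by
      rw [List.length_take]; exact min_eq_left (lcpLength_le_left _ _)
    have h4 := hT.connected.dist_triangle (u := l) (v := ⟨_, hpre⟩) (w := m)
    rw [SimpleGraph.dist_comm (u := l) (v := ⟨_, hpre⟩)] at h4
    omega
  · obtain ⟨p, hp⟩ := hT.connected.exists_walk_length_eq_dist m l
    rw [SimpleGraph.dist_comm, ← hp]
    -- Lower bound, by induction on the walk: appending a letter raises the common prefix with `v`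
    -- by at most one, and deleting a letter does not raise it.
    have : ∀ (u v : K) (q : (prefixGraph K).Walk u v),
        (v : List A).length + (u : List A).length ≤ q.length + 2 * lcpLength (v : List A) u := by
      intro u v q
      induction q with
      | nil => simp [lcpLength_self]; omega
      | @cons u w v huw q ih =>
        rw [SimpleGraph.Walk.length_cons]
        obtain ⟨c, hc | hc⟩ := prefixGraph_adj.1 huw
        · have := lcpLength_concat_le (v : List A) u c
          rw [hc, List.length_append, List.length_singleton] at ih
          omega
        · have := lcpLength_le_append (v : List A) w [c]
          rw [hc, List.length_append, List.length_singleton]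
          omega
    exact this m l p

end Prefix

/-! ### The compatible tree of a labelling -/

section Labelling

variable {S : Type u}

/-- The address of a point: its label followed by the point itself. -/
def address (ℓ : S → List ℕ) (x : S) : List (ℕ ⊕ S) := (ℓ x).map Sum.inl ++ [Sum.inr x]

/-- The nodes of the tree of a labelling: all prefixes of addresses. -/
def nodes (ℓ : S → List ℕ) : Set (List (ℕ ⊕ S)) := {l | ∃ x, l <+: address ℓ x}

variable (ℓ : S → List ℕ)

theorem mem_nodes_of_prefix (l m : List (ℕ ⊕ S)) (h : l <+: m) (hm : m ∈ nodes ℓ) :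
    l ∈ nodes ℓ := by
  obtain ⟨x, hx⟩ := hm
  exact ⟨x, h.trans hx⟩

theorem inr_mem_address {x y : S} : Sum.inr x ∈ address ℓ y ↔ x = y := by
  simp [address]

/-- The final letter `Sum.inr x` occurs in no address but that of `x`. Points with equal labels thus
remain distinct leaves, and no address properly extends another. -/
theorem eq_of_address_prefix {x : S} {t : List (ℕ ⊕ S)} {y : S}
    (h : address ℓ x ++ t <+: address ℓ y) : x = y ∧ t = [] := by
  have hxy : x = y := by
    rw [← inr_mem_address ℓ]
    exact h.subset (List.mem_append_left _ ((inr_mem_address ℓ).2 rfl))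
  subst hxy
  have := h.length_le
  rw [List.length_append] at this
  exact ⟨rfl, List.length_eq_zero_iff.1 (by omega)⟩

theorem address_injective : Function.Injective (address ℓ) := fun x y h =>
  (eq_of_address_prefix ℓ (t := []) (by rw [List.append_nil, h])).1

theorem lcpLength_address {x y : S} (h : x ≠ y) :
    lcpLength (address ℓ x) (address ℓ y) = lcpLength (ℓ x) (ℓ y) := by
  classical
  unfold address
  generalize ℓ x = l
  generalize ℓ y = m
  induction l generalizing m with
  | nil => cases m <;> simp [lcpLength_cons, h]
  | cons a l ih =>
    cases m with
    | nil => simp [lcpLength_cons]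
    | cons b m => simpa [lcpLength_cons] using by rw [ih m]

variable [Nonempty S]

theorem nil_mem_nodes : [] ∈ nodes ℓ := ⟨Classical.arbitrary S, List.nil_prefix⟩

theorem isLeaf_address (x : S) :
    IsLeaf (prefixGraph (nodes ℓ)) ⟨[], nil_mem_nodes ℓ⟩ ⟨address ℓ x, x, List.prefix_rfl⟩ := by
  refine ⟨fun h => by simpa [address] using congrArg Subtype.val h,
    ⟨(ℓ x).map Sum.inl, x, by simp [address]⟩, prefixGraph_adj.2 ⟨Sum.inr x, Or.inr rfl⟩, ?_⟩
  rintro ⟨m, y, hm⟩ hadj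
  obtain ⟨a, h | h⟩ := prefixGraph_adj.1 hadj
  · simp only at h
    rw [h] at hm
    simpa using (eq_of_address_prefix ℓ hm).2
  · exact Subtype.ext (List.append_inj_left' h rfl).symm

theorem exists_eq_of_not_isLeaf {v : nodes ℓ}
    (hv : ¬ IsLeaf (prefixGraph (nodes ℓ)) ⟨[], nil_mem_nodes ℓ⟩ v) :
    ∃ x, ∃ l, l <+: ℓ x ∧ (v : List (ℕ ⊕ S)) = l.map Sum.inl := by
  obtain ⟨v, x, hx⟩ := v
  rw [address, List.prefix_concat_iff] at hx
  rcases hx with rfl | hx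
  · exact absurd (isLeaf_address ℓ x) hv
  · obtain ⟨l, hl, rfl⟩ := (List.prefix_map_iff).1 hx
    exact ⟨x, l, hl, rfl⟩

theorem exists_address_of_isLeaf {v : nodes ℓ}
    (hv : IsLeaf (prefixGraph (nodes ℓ)) ⟨[], nil_mem_nodes ℓ⟩ v) :
    ∃ x, (v : List (ℕ ⊕ S)) = address ℓ x := by
  obtain ⟨h0, w, -, huniq⟩ := hv
  obtain ⟨v, x, t, ht⟩ := v
  refine ⟨x, ?_⟩
  rcases t with _ | ⟨a, t⟩
  · simpa using ht
  -- A nonempty proper prefix of an address has two neighbours: its parent and its one-letter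
  -- extension along the address.
  · exfalso
    rcases List.eq_nil_or_concat v with rfl | ⟨u, c, rfl⟩
    · exact h0 rfl
    · have e1 := huniq ⟨u, x, c :: a :: t, by simpa using ht⟩
        (prefixGraph_adj.2 ⟨c, Or.inr (by simp)⟩)
      have e2 := huniq ⟨u.concat c ++ [a], x, t, by simpa using ht⟩
        (prefixGraph_adj.2 ⟨a, Or.inl rfl⟩)
      simpa using congrArg (List.length ∘ Subtype.val) (e1.trans e2.symm)

/-- The compatible tree of a labelling with finitely many prefixes of labels, each of which
occurs on a measurable set. -/
def labelTree [MeasurableSpace S] (hfin : {l | ∃ x, l <+: ℓ x}.Finite)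
    (hmeas : ∀ l, MeasurableSet {x | l <+: ℓ x}) : CompatibleTree S where
  V := nodes ℓ
  G := prefixGraph (nodes ℓ)
  isTree := prefixGraph_isTree (mem_nodes_of_prefix ℓ) (nil_mem_nodes ℓ)
  root := ⟨[], nil_mem_nodes ℓ⟩
  leaf x := ⟨address ℓ x, x, List.prefix_rfl⟩
  leaf_injective _ _ h := address_injective ℓ (congrArg Subtype.val h)
  range_leaf := by
    ext v
    constructor
    · rintro ⟨x, rfl⟩
      exact isLeaf_address ℓ x
    · intro hv
      obtain ⟨x, hx⟩ := exists_address_of_isLeaf ℓ hv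
      exact ⟨x, Subtype.ext hx.symm⟩
  finite_nonleaf := by
    refine Set.Finite.of_finite_image ((hfin.image (List.map Sum.inl)).subset ?_)
      Subtype.val_injective.injOn
    rintro _ ⟨v, hv, rfl⟩
    obtain ⟨x, l, hl, e⟩ := exists_eq_of_not_isLeaf ℓ hv
    exact ⟨l, ⟨x, hl⟩, e.symm⟩
  measurableSet_leaves v hv := by
    obtain ⟨-, l, -, e⟩ := exists_eq_of_not_isLeaf ℓ hv
    convert hmeas l using 3 with x
    rw [isDescendant_prefixGraph_iff (mem_nodes_of_prefix ℓ), e]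
    simp only [address]
    rw [List.prefix_concat_iff]
    constructor
    · rintro (h | h)
      · have : Sum.inr x ∈ l.map (Sum.inl : ℕ → ℕ ⊕ S) := by rw [h]; simp
        simp at this
      · obtain ⟨l', hl', e'⟩ := (List.prefix_map_iff).1 h
        rwa [List.map_injective_iff.2 Sum.inl_injective e']
    · exact fun h => Or.inr (h.map _)

theorem gromovProduct_labelTree [MeasurableSpace S] (hfin : {l | ∃ x, l <+: ℓ x}.Finite)
    (hmeas : ∀ l, MeasurableSet {x | l <+: ℓ x}) (x y : S) :
    (labelTree ℓ hfin hmeas).gromovProduct x y = lcpLength (address ℓ x) (address ℓ y) := by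
  have h1 := dist_prefixGraph (mem_nodes_of_prefix ℓ) (nil_mem_nodes ℓ)
  have h2 := h1 ⟨address ℓ x, x, List.prefix_rfl⟩ ⟨[], nil_mem_nodes ℓ⟩
  have h3 := h1 ⟨address ℓ y, y, List.prefix_rfl⟩ ⟨[], nil_mem_nodes ℓ⟩
  have h4 := h1 ⟨address ℓ x, x, List.prefix_rfl⟩ ⟨address ℓ y, y, List.prefix_rfl⟩
  simp only [lcpLength_nil_right, List.length_nil, mul_zero, add_zero] at h2 h3
  rw [← h2, ← h3] at h4
  have h5 := congrArg (Nat.cast : ℕ → ℝ) h4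
  push_cast at h5
  simp only [CompatibleTree.gromovProduct, labelTree]
  linarith

/-- The slack of one is for the diagonal, where the whole address is shared. The diagonal may have
positive measure or be nonmeasurable, so it is absorbed into the error rather than discarded. -/
theorem gromovProduct_labelTree_mem [MeasurableSpace S] (hfin : {l | ∃ x, l <+: ℓ x}.Finite)
    (hmeas : ∀ l, MeasurableSet {x | l <+: ℓ x}) (x y : S) :
    (labelTree ℓ hfin hmeas).gromovProduct x y ∈
      Set.Icc (lcpLength (ℓ x) (ℓ y) : ℝ) (lcpLength (ℓ x) (ℓ y) + 1) := by
  rw [gromovProduct_labelTree]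
  by_cases h : x = y
  · subst h
    simp [lcpLength_self, address]
  · rw [lcpLength_address ℓ h]
    simp

end Labelling

/-! ### Clustering an almost transitive relation -/

section Clustering

variable {S : Type u}

/-- The triples of points of which exactly two pairs are related by the relation `R`. -/
def cherries (R : S → S → Prop) : Set (S × S × S) :=
  {q | (R q.1 q.2.1 ∧ R q.1 q.2.2 ∧ ¬ R q.2.1 q.2.2) ∨
    (R q.1 q.2.1 ∧ ¬ R q.1 q.2.2 ∧ R q.2.1 q.2.2) ∨
    (¬ R q.1 q.2.1 ∧ R q.1 q.2.2 ∧ R q.2.1 q.2.2)}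

/-- The pairs on which `R` differs from the relation of having the same nonzero label. -/
def misfits (R : S → S → Prop) (c : S → ℕ) : Set (S × S) :=
  {p | ¬ (R p.1 p.2 ↔ c p.1 = c p.2 ∧ c p.1 ≠ 0)}

/-- The misfits with at least one labelled point. -/
def labelledMisfits (R : S → S → Prop) (c : S → ℕ) : Set (S × S) :=
  {p | ¬ (c p.1 = 0 ∧ c p.2 = 0)} ∩ misfits R c

open Classical in
/-- Add the unlabelled points related to `z` as a new cluster. -/
noncomputable def addCluster (R : S → S → Prop) (c : S → ℕ) (n : ℕ) (z : S) (x : S) : ℕ :=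
  if c x = 0 ∧ R z x then n + 1 else c x

/-- Two new points, or a new and a still unlabelled one, form a cherry with `z` if they are a
misfit. A new and a previously labelled point have different labels before and after, as `n + 1` is
fresh by `hc`, so a misfit there is an old one. -/
theorem labelledMisfits_addCluster_subset {R : S → S → Prop} {c : S → ℕ} {n : ℕ}
    (hc : ∀ x, c x ≤ n) (z : S) :
    labelledMisfits R (addCluster R c n z) ⊆
      labelledMisfits R c ∪ Prod.mk z ⁻¹' cherries R := by
  rintro ⟨x, y⟩ ⟨h1, h2⟩
  have hx := hc x
  have hy := hc y
  simp only [labelledMisfits, misfits, cherries, addCluster, Set.mem_union, Set.mem_inter_iff,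
    Set.mem_ofPred_eq, Set.mem_preimage] at h1 h2 ⊢
  by_cases ex : c x = 0 <;> by_cases ey : c y = 0 <;> by_cases rx : R z x <;>
    by_cases ry : R z y <;> by_cases rxy : R x y <;> simp [ex, ey, rx, ry, rxy] at h1 h2 ⊢ <;>
    grind

theorem setOf_addCluster_ne_zero (R : S → S → Prop) (c : S → ℕ) (n : ℕ) (z : S) :
    {x | addCluster R c n z x ≠ 0} = {x | c x ≠ 0} ∪ {x | c x = 0 ∧ R z x} := by
  ext x
  simp only [addCluster, Set.mem_ofPred_eq, Set.mem_union]
  grind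

variable [MeasurableSpace S]

theorem measurableSet_related {R : S → S → Prop} (hm : MeasurableSet {p : S × S | R p.1 p.2})
    {α : Type*} [MeasurableSpace α] {f g : α → S} (hf : Measurable f) (hg : Measurable g) :
    MeasurableSet {a | R (f a) (g a)} :=
  (hf.prodMk hg) hm

theorem measurableSet_cherries {R : S → S → Prop}
    (hm : MeasurableSet {p : S × S | R p.1 p.2}) : MeasurableSet (cherries R) := by
  have h1 : MeasurableSet {q : S × S × S | R q.1 q.2.1} :=
    measurableSet_related hm (by fun_prop) (by fun_prop)
  have h2 : MeasurableSet {q : S × S × S | R q.1 q.2.2} :=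
    measurableSet_related hm (by fun_prop) (by fun_prop)
  have h3 : MeasurableSet {q : S × S × S | R q.2.1 q.2.2} :=
    measurableSet_related hm (by fun_prop) (by fun_prop)
  exact (h1.inter (h2.inter h3.compl)).union
    ((h1.inter (h2.compl.inter h3)).union (h1.compl.inter (h2.inter h3)))

theorem measurableSet_misfits {R : S → S → Prop} (hm : MeasurableSet {p : S × S | R p.1 p.2})
    {c : S → ℕ} (hc : Measurable c) : MeasurableSet (misfits R c) := by
  have h1 : MeasurableSet {p : S × S | c p.1 = c p.2 ∧ c p.1 ≠ 0} :=
    (measurableSet_eq_fun (hc.comp measurable_fst) (hc.comp measurable_snd)).inter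
      ((hc.comp measurable_fst) (measurableSet_singleton 0)).compl
  exact (MeasurableSet.iff hm h1).compl

theorem measurable_addCluster {R : S → S → Prop} (hm : MeasurableSet {p : S × S | R p.1 p.2})
    {c : S → ℕ} (hc : Measurable c) (n : ℕ) (z : S) : Measurable (addCluster R c n z) :=
  Measurable.ite ((hc (measurableSet_singleton 0)).inter
    (measurableSet_related hm measurable_const measurable_id)) measurable_const hc

variable (P : Measure S)

/-- A labelling by at most `n` clusters, each of measure at least `a` and with misfits of measure
at most `κ`. -/
structure IsClustering (R : S → S → Prop) (a κ : ℝ≥0∞) (n : ℕ) (c : S → ℕ) : Prop where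
  measurable : Measurable c
  le : ∀ x, c x ≤ n
  misfits_le : (P.prod P) (labelledMisfits R c) ≤ n * κ
  le_labelled : n * a ≤ P {x | c x ≠ 0}

variable {P}

theorem IsClustering.addCluster {R : S → S → Prop}
    (hm : MeasurableSet {p : S × S | R p.1 p.2}) {a κ : ℝ≥0∞} {n : ℕ} {c : S → ℕ}
    (hc : IsClustering P R a κ n c) {z : S}
    (hz : (P.prod P) (Prod.mk z ⁻¹' cherries R) ≤ κ) (hza : a ≤ P {x | c x = 0 ∧ R z x}) :
    IsClustering P R a κ (n + 1) (addCluster R c n z) where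
  measurable := measurable_addCluster hm hc.measurable n z
  le x := by
    have := hc.le x
    unfold AvgHyp.addCluster
    split_ifs <;> omega
  misfits_le := by
    refine (measure_mono (labelledMisfits_addCluster_subset hc.le z)).trans
      ((measure_union_le _ _).trans ?_)
    push_cast
    rw [add_mul, one_mul]
    exact add_le_add hc.misfits_le hz
  le_labelled := by
    have hmeas : MeasurableSet {x | c x = 0 ∧ R z x} :=
      (hc.measurable (measurableSet_singleton 0)).inter
        (measurableSet_related hm measurable_const measurable_id)
    rw [setOf_addCluster_ne_zero, measure_union _ hmeas]
    · push_cast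
      rw [add_mul, one_mul]
      exact add_le_add hc.le_labelled hza
    · exact Set.disjoint_left.2 fun x hx hx' => hx hx'.1

variable [IsProbabilityMeasure P]

/-- Each greedy step labels fresh points of measure at least `a`, so `n * a ≤ 1` bounds the number
of steps. -/
theorem exists_maximal_clustering {R : S → S → Prop}
    (hm : MeasurableSet {p : S × S | R p.1 p.2}) {a : ℝ≥0∞} (ha : a ≠ 0) (κ : ℝ≥0∞) :
    ∃ n c, IsClustering P R a κ n c ∧
      ∀ z, (P.prod P) (Prod.mk z ⁻¹' cherries R) ≤ κ → P {x | c x = 0 ∧ R z x} < a := by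
  by_contra! hcon
  have hall : ∀ n, ∃ c, IsClustering P R a κ n c := by
    intro n
    induction n with
    | zero =>
      exact ⟨fun _ => 0, measurable_const, fun _ => le_rfl, by simp [labelledMisfits], by simp⟩
    | succ n ih =>
      obtain ⟨c, hc⟩ := ih
      obtain ⟨z, hz, hza⟩ := hcon n c hc
      exact ⟨_, hc.addCluster hm hz hza⟩
  obtain ⟨n, hn⟩ := ENNReal.exists_nat_mul_gt ha ENNReal.one_ne_top
  obtain ⟨c, hc⟩ := hall n
  exact absurd (hc.le_labelled.trans prob_le_one) (not_le.2 hn)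

/-- A relation with few cherries is close to the relation of having the same nonzero
label, for a labelling with finitely many labels. -/
theorem exists_clustering {R : S → S → Prop}
    (hm : MeasurableSet {p : S × S | R p.1 p.2}) {a : ℝ≥0∞} (ha : a ≠ 0) (ha' : a ≠ ∞)
    (h : (P.prod (P.prod P)) (cherries R) ≤ a ^ 3) :
    ∃ c : S → ℕ, Measurable c ∧ (∃ n, ∀ x, c x ≤ n) ∧ (P.prod P) (misfits R c) ≤ 3 * a := by
  obtain ⟨n, c, hc, hmax⟩ := exists_maximal_clustering (P := P) hm ha (a ^ 2)
  refine ⟨c, hc.measurable, ⟨n, hc.le⟩, ?_⟩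
  have hT : Measurable fun z => (P.prod P) (Prod.mk z ⁻¹' cherries R) :=
    measurable_measure_prodMk_left (measurableSet_cherries hm)
  -- Markov's inequality: `a ^ 2 * P B ≤ a ^ 3`.
  have hbad : P {z | a ^ 2 ≤ (P.prod P) (Prod.mk z ⁻¹' cherries R)} ≤ a := by
    have h1 := mul_meas_ge_le_lintegral (μ := P) hT (a ^ 2)
    rw [← Measure.prod_apply (measurableSet_cherries hm)] at h1
    refine (ENNReal.mul_le_mul_iff_right (pow_ne_zero 2 ha) (ENNReal.pow_ne_top ha')).1
      (h1.trans (h.trans (le_of_eq ?_)))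
    ring
  set B := {z | a ^ 2 ≤ (P.prod P) (Prod.mk z ⁻¹' cherries R)} with hB
  have hBm : MeasurableSet B := measurableSet_le measurable_const hT
  -- Only the second point is required to be unlabelled, so that the section over `z` is the set
  -- which maximality bounds by `a` for `z` outside `B`.
  set U : Set (S × S) := {p | c p.2 = 0 ∧ R p.1 p.2}
  have hU : MeasurableSet U :=
    ((hc.measurable.comp measurable_snd) (measurableSet_singleton 0)).inter hm
  have hUle : (P.prod P) U ≤ a + a := by
    rw [Measure.prod_apply hU]
    calc ∫⁻ z, P (Prod.mk z ⁻¹' U) ∂P ≤ ∫⁻ z, (a + B.indicator 1 z) ∂P := by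
          refine lintegral_mono fun z => ?_
          by_cases hz : z ∈ B
          · simp only [Set.indicator_of_mem hz, Pi.one_apply]
            exact prob_le_one.trans le_add_self
          · exact ((hmax z (not_le.1 hz).le).le).trans le_self_add
      _ ≤ a + a := by
          rw [lintegral_add_left measurable_const, lintegral_indicator_one hBm]
          simpa using add_le_add_right hbad a
  have hsub : misfits R c ⊆ labelledMisfits R c ∪ U := by
    rintro p hp
    by_cases h0 : c p.1 = 0 ∧ c p.2 = 0
    · refine Or.inr ⟨h0.2, ?_⟩
      simpa [misfits, h0.1] using hp
    · exact Or.inl ⟨h0, hp⟩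
  have hlab : (P.prod P) (labelledMisfits R c) ≤ a := by
    refine hc.misfits_le.trans ?_
    -- `n * a ^ 2 ≤ a`, because the `n` clusters give `n * a ≤ 1`.
    rw [pow_two, ← mul_assoc]
    exact mul_le_of_le_one_left' (hc.le_labelled.trans prob_le_one)
  calc (P.prod P) (misfits R c) ≤ a + (a + a) :=
        (measure_mono hsub).trans ((measure_union_le _ _).trans (add_le_add hlab hUle))
    _ = 3 * a := by ring

end Clustering

/-! ### Choosing thresholds -/

section Threshold

variable {S : Type u} [MeasurableSpace S] {b : ℝ} {s : S → S → ℝ}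

/-- In a cherry, `t` separates the smallest of the three similarities from the other two; the three
intervals correspond to the choice of the smallest. -/
theorem setOf_mem_cherries_subset (hs : IsSimilarity b s) (x y z : S) :
    {t : ℝ | (z, x, y) ∈ cherries fun x y => t < s x y} ⊆
      Set.Ico (s x y) (min (s x z) (s y z)) ∪
        (Set.Ico (s z y) (min (s z x) (s y x)) ∪ Set.Ico (s z x) (min (s z y) (s x y))) := by
  intro t ht
  simp only [cherries, Set.mem_ofPred_eq, not_lt] at ht
  simp only [Set.mem_union, Set.mem_Ico, lt_min_iff]
  rw [hs.symm z x, hs.symm z y, hs.symm y x] at *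
  tauto

theorem volume_setOf_mem_cherries_le (hs : IsSimilarity b s) (x y z : S) :
    volume {t : ℝ | (z, x, y) ∈ cherries fun x y => t < s x y} ≤
      ENNReal.ofReal (excess s x y z) +
        (ENNReal.ofReal (excess s z y x) + ENNReal.ofReal (excess s z x y)) := by
  have h : ∀ x y z, volume (Set.Ico (s x y) (min (s x z) (s y z))) ≤
      ENNReal.ofReal (excess s x y z) := fun x y z => by
    rw [Real.volume_Ico]
    exact ENNReal.ofReal_le_ofReal (le_max_left _ _)
  have h2 := h z x y
  refine (measure_mono (setOf_mem_cherries_subset hs x y z)).trans ?_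
  refine (measure_union_le _ _).trans (add_le_add (h x y z) ?_)
  exact (measure_union_le _ _).trans (add_le_add (h z y x) (h z x y))

variable (P : Measure S) [IsProbabilityMeasure P]

/-- Tonelli moves the integral over `t` inside, and the three excess terms have equal integrals
because the coordinates are exchangeable. -/
theorem lintegral_cherries_le (hs : IsSimilarity b s) :
    ∫⁻ t : ℝ, (P.prod (P.prod P)) (cherries fun x y => t < s x y) ≤
      3 * ENNReal.ofReal (Hyp P s) := by
  have hE : MeasurableSet {q : ℝ × S × S × S | q.2 ∈ cherries fun x y => q.1 < s x y} := by
    have h1 : MeasurableSet {q : ℝ × S × S × S | q.1 < s q.2.1 q.2.2.1} :=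
      measurableSet_lt measurable_fst (hs.measurable_comp (by fun_prop) (by fun_prop))
    have h2 : MeasurableSet {q : ℝ × S × S × S | q.1 < s q.2.1 q.2.2.2} :=
      measurableSet_lt measurable_fst (hs.measurable_comp (by fun_prop) (by fun_prop))
    have h3 : MeasurableSet {q : ℝ × S × S × S | q.1 < s q.2.2.1 q.2.2.2} :=
      measurableSet_lt measurable_fst (hs.measurable_comp (by fun_prop) (by fun_prop))
    exact (h1.inter (h2.inter h3.compl)).union
      ((h1.inter (h2.compl.inter h3)).union (h1.compl.inter (h2.inter h3)))
  have hm1 : Measurable fun q : S × S × S => ENNReal.ofReal (excess s q.2.1 q.2.2 q.1) :=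
    (hs.measurable_excess (by fun_prop) (by fun_prop) (by fun_prop)).ennreal_ofReal
  have hm2 : Measurable fun q : S × S × S => ENNReal.ofReal (excess s q.1 q.2.2 q.2.1) :=
    (hs.measurable_excess (by fun_prop) (by fun_prop) (by fun_prop)).ennreal_ofReal
  have hm3 : Measurable fun q : S × S × S => ENNReal.ofReal (excess s q.1 q.2.1 q.2.2) :=
    (hs.measurable_excess (by fun_prop) (by fun_prop) (by fun_prop)).ennreal_ofReal
  have hI : ∀ {f : S × S × S → ℝ≥0∞}, Measurable f → ∫⁻ q, f q ∂(P.prod (P.prod P)) =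
      ∫⁻ x, ∫⁻ y, ∫⁻ z, f (x, y, z) ∂P ∂P ∂P := by
    intro f hf
    rw [lintegral_prod _ hf.aemeasurable]
    exact lintegral_congr fun x => lintegral_prod _
      (hf.comp (by fun_prop : Measurable fun q : S × S => (x, q))).aemeasurable
  have hswap : ∀ {f : S × S → ℝ≥0∞}, Measurable f →
      ∫⁻ x, ∫⁻ y, f (x, y) ∂P ∂P = ∫⁻ y, ∫⁻ x, f (x, y) ∂P ∂P :=
    fun {f} hf => lintegral_lintegral_swap (f := fun x y => f (x, y)) hf.aemeasurable
  have e3 : ∫⁻ q, ENNReal.ofReal (excess s q.1 q.2.1 q.2.2) ∂(P.prod (P.prod P)) =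
      ENNReal.ofReal (Hyp P s) := by
    rw [hI hm3, ofReal_hyp P hs]
  have e2 : ∫⁻ q, ENNReal.ofReal (excess s q.1 q.2.2 q.2.1) ∂(P.prod (P.prod P)) =
      ENNReal.ofReal (Hyp P s) := by
    rw [hI hm2, ofReal_hyp P hs]
    exact lintegral_congr fun z =>
      hswap (hm2.comp (by fun_prop : Measurable fun q : S × S => (z, q)))
  have e1 : ∫⁻ q, ENNReal.ofReal (excess s q.2.1 q.2.2 q.1) ∂(P.prod (P.prod P)) =
      ENNReal.ofReal (Hyp P s) := by
    rw [hI hm1, ofReal_hyp P hs]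
    have hm : Measurable fun q : (S × S) × S => ENNReal.ofReal (excess s q.1.2 q.2 q.1.1) :=
      hm1.comp (by fun_prop : Measurable fun q : (S × S) × S => (q.1.1, q.1.2, q.2))
    refine (hswap hm.lintegral_prod_right').trans (lintegral_congr fun x => ?_)
    exact hswap (hm1.comp (by fun_prop : Measurable fun q : S × S => (q.1, x, q.2)))
  calc ∫⁻ t : ℝ, (P.prod (P.prod P)) (cherries fun x y => t < s x y)
      = ∫⁻ q : S × S × S, volume {t : ℝ | q ∈ cherries fun x y => t < s x y}
          ∂(P.prod (P.prod P)) :=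
        (Measure.prod_apply (μ := (volume : Measure ℝ)) hE).symm.trans
          (Measure.prod_apply_symm hE)
    _ ≤ ∫⁻ q : S × S × S, (ENNReal.ofReal (excess s q.2.1 q.2.2 q.1) +
          (ENNReal.ofReal (excess s q.1 q.2.2 q.2.1) + ENNReal.ofReal (excess s q.1 q.2.1 q.2.2)))
          ∂(P.prod (P.prod P)) :=
        lintegral_mono fun q => volume_setOf_mem_cherries_le hs q.2.1 q.2.2 q.1
    _ = 3 * ENNReal.ofReal (Hyp P s) := by
        rw [lintegral_add_left hm1, lintegral_add_left hm2, e1, e2, e3]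
        ring

theorem exists_threshold (hs : IsSimilarity b s) {u v : ℝ} {β : ℝ≥0∞}
    (h : 3 * ENNReal.ofReal (Hyp P s) < β * ENNReal.ofReal (v - u)) :
    ∃ t ∈ Set.Ioo u v, (P.prod (P.prod P)) (cherries fun x y => t < s x y) ≤ β := by
  by_contra! hcon
  refine absurd h (not_lt.2 ?_)
  calc β * ENNReal.ofReal (v - u) = ∫⁻ _ in Set.Ioo u v, β := by simp
    _ ≤ ∫⁻ t in Set.Ioo u v, (P.prod (P.prod P)) (cherries fun x y => t < s x y) :=
        setLIntegral_mono' measurableSet_Ioo fun t ht => (hcon t ht).le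
    _ ≤ _ := (setLIntegral_le_lintegral _ _).trans (lintegral_cherries_le P hs)

end Threshold

/-! ### Hierarchical labels -/

section Label

variable {S : Type u}

/-- The longest initial segment of `c 0 x, …, c (k - 1) x` consisting of nonzero labels. -/
def label : ℕ → (ℕ → S → ℕ) → S → List ℕ
  | 0, _, _ => []
  | k + 1, c, x => if c 0 x = 0 then [] else c 0 x :: label k (fun i => c (i + 1)) x

theorem finite_prefix_label (k : ℕ) (c : ℕ → S → ℕ) (hc : ∀ i, ∃ n, ∀ x, c i x ≤ n) :
    {l | ∃ x, l <+: label k c x}.Finite := by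
  induction k generalizing c with
  | zero => exact (Set.finite_singleton []).subset fun l ⟨x, hx⟩ => by simpa [label] using hx
  | succ k ih =>
    obtain ⟨n, hn⟩ := hc 0
    refine ((Set.finite_singleton []).union ((Set.finite_Iic n).image2 List.cons
      (ih (fun i => c (i + 1)) fun i => hc (i + 1)))).subset ?_
    rintro (_ | ⟨a, l⟩) ⟨x, hx⟩
    · exact Or.inl rfl
    · rw [label] at hx
      split_ifs at hx with h0
      · simp at hx
      · rw [List.cons_prefix_cons] at hx
        exact Or.inr ⟨a, hx.1 ▸ hn x, l, ⟨x, hx.2⟩, rfl⟩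

theorem measurableSet_prefix_label [MeasurableSpace S] (k : ℕ) (c : ℕ → S → ℕ)
    (hc : ∀ i, Measurable (c i)) (l : List ℕ) : MeasurableSet {x | l <+: label k c x} := by
  induction k generalizing c l with
  | zero => simp [label]
  | succ k ih =>
    rcases l with _ | ⟨a, l⟩
    · simp
    · have : {x | a :: l <+: label (k + 1) c x} =
          {x | c 0 x ≠ 0} ∩ ({x | c 0 x = a} ∩ {x | l <+: label k (fun i => c (i + 1)) x}) := by
        ext x
        simp only [label, Set.mem_ofPred_eq, Set.mem_inter_iff]
        split_ifs with h0
        · simp [h0]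
        · simp [h0, List.cons_prefix_cons, eq_comm]
      rw [this]
      exact ((hc 0) (measurableSet_singleton 0)).compl.inter
        (((hc 0) (measurableSet_singleton a)).inter (ih _ (fun i => hc (i + 1)) l))

theorem lcpLength_label (k : ℕ) (c : ℕ → S → ℕ) (x y : S) :
    lcpLength (label k c x) (label k c y) ≤ k ∧
      (∀ j < lcpLength (label k c x) (label k c y), c j x = c j y ∧ c j x ≠ 0) ∧
      (lcpLength (label k c x) (label k c y) < k →
        ¬ (c (lcpLength (label k c x) (label k c y)) x =
          c (lcpLength (label k c x) (label k c y)) y ∧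
          c (lcpLength (label k c x) (label k c y)) x ≠ 0)) := by
  induction k generalizing c with
  | zero => simp [label]
  | succ k ih =>
    obtain ⟨h1, h2, h3⟩ := ih fun i => c (i + 1)
    by_cases h : c 0 x = c 0 y ∧ c 0 x ≠ 0
    · have hy : c 0 y ≠ 0 := h.1 ▸ h.2
      have e : lcpLength (label (k + 1) c x) (label (k + 1) c y) =
          lcpLength (label k (fun i => c (i + 1)) x) (label k (fun i => c (i + 1)) y) + 1 := by
        simp only [label, if_neg h.2, if_neg hy, lcpLength_cons, if_pos h.1]
      rw [e]
      refine ⟨by omega, fun j hj => ?_, fun hlt => h3 (by omega)⟩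
      rcases j with _ | j
      · exact h
      · exact h2 j (by omega)
    · have e : lcpLength (label (k + 1) c x) (label (k + 1) c y) = 0 := by
        by_cases hx : c 0 x = 0
        · simp [label, hx]
        · by_cases hy : c 0 y = 0
          · simp [label, hy]
          · have hne : c 0 x ≠ c 0 y := fun e => h ⟨e, hx⟩
            simp [label, hx, hy, lcpLength_cons, hne]
      rw [e]
      exact ⟨by omega, by simp, fun _ => h⟩

/-- With `n` the common prefix length, agreement at level `n - 1` gives `r > t (n - 1)`, and
disagreement at level `n` gives `r ≤ t n`. At `n = 0` and `n = k` the bounds `0 ≤ r` and `r ≤ b ≤ k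
* η` take over. -/
theorem abs_sub_lcpLength_label_le {k : ℕ} {c : ℕ → S → ℕ} {b η r : ℝ} (hη : 0 < η)
    (hk : b ≤ k * η) {t : ℕ → ℝ} (ht : ∀ i : ℕ, t i ∈ Set.Ioo (i * η) ((i + 1) * η))
    (hr0 : 0 ≤ r) (hrb : r ≤ b) {x y : S}
    (h : ∀ i < k, t i < r ↔ c i x = c i y ∧ c i x ≠ 0) :
    |r - η * lcpLength (label k c x) (label k c y)| ≤ η := by
  obtain ⟨h1, h2, h3⟩ := lcpLength_label k c x y
  set n := lcpLength (label k c x) (label k c y)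
  have hle : r ≤ (n + 1) * η := by
    rcases h1.lt_or_eq with hlt | heq
    · have := not_lt.1 (mt (h n hlt).1 (h3 hlt))
      exact this.trans (ht n).2.le
    · rw [heq]
      nlinarith
  have hge : (n - 1) * η ≤ r := by
    rcases Nat.eq_zero_or_pos n with h0 | hpos
    · rw [h0]; push_cast; linarith
    · obtain ⟨m, hm⟩ := Nat.exists_eq_succ_of_ne_zero hpos.ne'
      have h4 := (h m (by omega)).2 (h2 m (by omega))
      have h5 := (ht m).1
      rw [hm]; push_cast
      linarith
  rw [abs_le]
  constructor <;> linarith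

end Label

/-! ### Small average hyperbolicity implies tree-likeness -/

section Main

variable {S : Type u} [MeasurableSpace S] {b : ℝ} {s : S → S → ℝ}
  (P : Measure S) [IsProbabilityMeasure P]

theorem tree_le_of_hyp_lt (hs : IsSimilarity b s) {η a : ℝ} (hη : 0 < η) (ha : 0 < a) {k : ℕ}
    (hk : b ≤ k * η) (h : 3 * Hyp P s < a ^ 3 * η) :
    Tree P s ≤ ENNReal.ofReal (2 * η + k * ((b + k * η) * (3 * a))) := by
  have : Nonempty S := nonempty_of_isProbabilityMeasure P
  have hb : 0 ≤ b := (hs.nonneg (Classical.arbitrary S) (Classical.arbitrary S)).trans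
    (hs.le_bound _ _)
  have hth : ∀ i : ℕ, ∃ t ∈ Set.Ioo (i * η) ((i + 1) * η),
      (P.prod (P.prod P)) (cherries fun x y => t < s x y) ≤ ENNReal.ofReal a ^ 3 := by
    intro i
    refine exists_threshold P hs ?_
    have e : (3 : ℝ≥0∞) = ENNReal.ofReal 3 := by norm_num
    rw [e, ← ENNReal.ofReal_mul (by norm_num), ← ENNReal.ofReal_pow ha.le,
      ← ENNReal.ofReal_mul (by positivity)]
    have e2 : (i + 1) * η - i * η = η := by ring
    rw [e2]
    exact (ENNReal.ofReal_lt_ofReal_iff (by positivity)).2 h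
  choose t ht hβ using hth
  have hR : ∀ i : ℕ, MeasurableSet {p : S × S | t i < s p.1 p.2} := fun i =>
    measurableSet_lt measurable_const hs.measurable
  have hcl : ∀ i : ℕ, ∃ c : S → ℕ, Measurable c ∧ (∃ n, ∀ x, c x ≤ n) ∧
      (P.prod P) (misfits (fun x y => t i < s x y) c) ≤ 3 * ENNReal.ofReal a := fun i =>
    exists_clustering (hR i)
      (ENNReal.ofReal_pos.2 ha).ne' ENNReal.ofReal_ne_top (hβ i)
  choose c hcm hcb hcl using hcl
  set D : ℕ → Set (S × S) := fun i => misfits (fun x y => t i < s x y) (c i)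
  have hD : ∀ i, MeasurableSet (D i) := fun i => measurableSet_misfits (hR i) (hcm i)
  set C : ℝ := b + k * η
  have hC : 0 ≤ C := by positivity
  set T := labelTree (label k c) (finite_prefix_label k c hcb) (measurableSet_prefix_label k c hcm)
  -- One `η` pays for discretising `s`, the other for the diagonal; `C` bounds `|s - η n|` on pairs
  -- misfitting at some level.
  set g : S × S → ℝ≥0∞ := fun p => ENNReal.ofReal (2 * η) +
    ∑ i ∈ Finset.range k, (D i).indicator (fun _ => ENNReal.ofReal C) p
  have hg : Measurable g := Measurable.const_add
    (Finset.measurable_fun_sum _ fun i _ => measurable_const.indicator (hD i)) _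
  have hle : (fun p : S × S => ENNReal.ofReal |s p.1 p.2 - η * T.gromovProduct p.1 p.2|) ≤ g := by
    rintro ⟨x, y⟩
    obtain ⟨hT1, hT2⟩ := gromovProduct_labelTree_mem (label k c) (finite_prefix_label k c hcb)
      (measurableSet_prefix_label k c hcm) x y
    set n := lcpLength (label k c x) (label k c y) with hn
    have hdev : |s x y - η * T.gromovProduct x y| ≤ |s x y - η * n| + η := by
      have e : s x y - η * T.gromovProduct x y =
        (s x y - η * n) + -(η * (T.gromovProduct x y - n)) := by ring
      rw [e]
      refine (abs_add_le _ _).trans (add_le_add le_rfl ?_)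
      rw [abs_neg, abs_of_nonneg (mul_nonneg hη.le (sub_nonneg.2 hT1))]
      nlinarith
    by_cases hbad : ∃ i ∈ Finset.range k, (x, y) ∈ D i
    · obtain ⟨i, hi, hxy⟩ := hbad
      have h1 : |s x y - η * n| ≤ C := by
        have hnk : (n : ℝ) ≤ k := by exact_mod_cast (lcpLength_label k c x y).1
        have h2 := hs.nonneg x y
        have h3 := hs.le_bound x y
        have h4 : 0 ≤ η * (n : ℝ) := by positivity
        have h5 : η * (n : ℝ) ≤ k * η := by nlinarith
        have h6 : 0 ≤ k * η := by positivity
        rw [abs_le]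
        constructor <;> linarith
      calc ENNReal.ofReal |s x y - η * T.gromovProduct x y|
          ≤ ENNReal.ofReal (2 * η + C) := ENNReal.ofReal_le_ofReal (by linarith)
        _ = ENNReal.ofReal (2 * η) + ENNReal.ofReal C :=
            ENNReal.ofReal_add (by positivity) hC
        _ = ENNReal.ofReal (2 * η) + (D i).indicator (fun _ => ENNReal.ofReal C) (x, y) := by
            rw [Set.indicator_of_mem hxy]
        _ ≤ g (x, y) := add_le_add le_rfl (Finset.single_le_sum
            (f := fun i => (D i).indicator (fun _ => ENNReal.ofReal C) (x, y))
            (fun _ _ => zero_le) hi)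
    · push Not at hbad
      have h1 : |s x y - η * n| ≤ η :=
        abs_sub_lcpLength_label_le hη hk ht (hs.nonneg x y) (hs.le_bound x y) fun i hi =>
          not_not.1 (hbad i (Finset.mem_range.2 hi))
      exact (ENNReal.ofReal_le_ofReal (by linarith)).trans le_self_add
  calc Tree P s ≤ ∫⁻ p, g p ∂(P.prod P) :=
        iInf_le_of_le T (iInf_le_of_le η (iInf_le_of_le hη.le
          (iInf_le_of_le g (iInf_le_of_le hg (iInf_le _ hle)))))
    _ = ENNReal.ofReal (2 * η) +
          ∑ i ∈ Finset.range k, ENNReal.ofReal C * (P.prod P) (D i) := by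
        rw [lintegral_add_left measurable_const, lintegral_finsetSum _ fun i _ =>
          measurable_const.indicator (hD i)]
        simp [hD]
    _ ≤ ENNReal.ofReal (2 * η) +
          ∑ i ∈ Finset.range k, ENNReal.ofReal C * (3 * ENNReal.ofReal a) := by
        gcongr with i
        exact hcl i
    _ = ENNReal.ofReal (2 * η + k * (C * (3 * a))) := by
        rw [Finset.sum_const, Finset.card_range, nsmul_eq_mul,
          ENNReal.ofReal_add (q := k * (C * (3 * a))) (by positivity) (by positivity),
          ENNReal.ofReal_mul (p := (k : ℝ)) (by positivity), ENNReal.ofReal_mul hC,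
          ENNReal.ofReal_mul (p := (3 : ℝ)) (by norm_num), ENNReal.ofReal_natCast,
          ENNReal.ofReal_ofNat]

theorem exists_forall_tree_lt (b : ℝ) (hb : 0 < b) {ε : ℝ} (hε : 0 < ε) :
    ∃ δ : ℝ, 0 < δ ∧ ∀ (S : Type u) [MeasurableSpace S] (P : Measure S) [IsProbabilityMeasure P]
      (s : S → S → ℝ), IsSimilarity b s → Hyp P s < δ → Tree P s < ENNReal.ofReal ε := by
  obtain ⟨k, hk⟩ := exists_nat_ge (b / (ε / 4))
  have hk' : b ≤ k * (ε / 4) := (div_le_iff₀ (by positivity)).1 hk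
  -- With `η = ε / 4` the error bound is `ε / 2 + K * a`, and `a` is chosen to make the second term
  -- at most `ε / 4`.
  set K : ℝ := 3 * (k * (b + k * (ε / 4)))
  have hK : 0 ≤ K := by positivity
  set a : ℝ := ε / (4 * (K + 1))
  have ha : 0 < a := by positivity
  have hKa : K * a ≤ ε / 4 := by
    have e : (K + 1) * a = ε / 4 := by simp only [a]; field_simp
    linarith
  refine ⟨a ^ 3 * (ε / 4) / 3, by positivity, fun S _ P _ s hs h => ?_⟩
  refine (tree_le_of_hyp_lt P hs (by positivity) ha hk' (by linarith)).trans_lt ?_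
  rw [ENNReal.ofReal_lt_ofReal_iff hε]
  have e : k * ((b + k * (ε / 4)) * (3 * a)) = K * a := by ring
  rw [e]
  linarith

end Main

end AvgHyp

theorem mainTheorem1 :
    (∀ b : ℝ, 0 < b → ∀ ε : ℝ, 0 < ε → ∃ δ : ℝ, 0 < δ ∧
      ∀ (S : Type u) [MeasurableSpace S] [MeasurableSpace.CountablyGenerated S]
        (P : Measure S) [IsProbabilityMeasure P] (s : S → S → ℝ), AvgHyp.IsSimilarity b s →
        AvgHyp.Hyp P s < δ → AvgHyp.Tree P s < ENNReal.ofReal ε) ∧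
    (∀ b : ℝ, 0 < b → ∀ ε : ℝ, 0 < ε → ∃ δ : ℝ, 0 < δ ∧
      ∀ (S : Type u) [MeasurableSpace S] [MeasurableSpace.CountablyGenerated S]
        (P : Measure S) [IsProbabilityMeasure P] (s : S → S → ℝ), AvgHyp.IsSimilarity b s →
        AvgHyp.Tree P s < ENNReal.ofReal δ → AvgHyp.Hyp P s < ε) ∧
    (∀ (S : Type u) [MeasurableSpace S] [MeasurableSpace.CountablyGenerated S]
        (P : Measure S) [IsProbabilityMeasure P] (s : S → S → ℝ), AvgHyp.IsSimilarity 1 s →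
        ∀ δ : ℝ, 0 < δ → AvgHyp.Tree P s < ENNReal.ofReal δ →
          AvgHyp.Hyp P s ≤ 5 * Real.sqrt δ) := by
  refine ⟨fun b hb ε hε => ?_, fun b _ ε hε => ?_, fun S _ _ P _ s hs δ hδ h =>
    AvgHyp.hyp_le_five_sqrt P hs hδ h⟩
  · obtain ⟨δ, hδ, h⟩ := AvgHyp.exists_forall_tree_lt b hb hε
    exact ⟨δ, hδ, fun S _ _ P _ s hs => h S P s hs⟩
  · refine ⟨ε / 4, by positivity, fun S _ _ P _ s hs h => ?_⟩
    linarith [AvgHyp.hyp_le_of_tree_lt P hs (by positivity : 0 < ε / 4) h]
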